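/- Let $\mathcal W$ (parameters) and $\mathcal X$ (observations) be standard Borel spaces, $\mathcal Y=\{0,1\}$, and let $\mathcal A$ be a nonempty measurable action space. Let $P_W$ be a prior on $\mathcal W$ and $P_{Z|W}$, with $Z=(X,Y)$, a Markov kernel from $\mathcal W$ to $\mathcal X\times\mathcal Y$; given $W$, the data $Z^n=(Z_1,\dots,Z_n)$ and the fresh pair $Z=(X,Y)$ are i.i.d. with law $P_{Z|W}$. For a measurable loss $\ell:\mathcal Y\times\mathcal A\to\mathbb R$ define the minimum excess risk $$\mathrm{MER}_\ell=\inf_{\psi}\mathbb E[\ell(Y,\psi(X,Z^n))]-\inf_{\Psi}\mathbb E[\ell(Y,\Psi(X,W))],$$ the infima being over all measurable $\psi:\mathcal X\times(\mathcal X\times\mathcal Y)^n\to\mathcal A$ and $\Psi:\mathcal X\times\mathcal W\to\mathcal A$ for which the expectation is defined. Suppose that the model is realizable: $Y=g(X,W)$ almost surely for a measurable $g:\mathcal X\times\mathcal W\to\{0,1\}$, and that the class $\mathcal G=\{g(\cdot,w):w\in\mathcal W\}$ has finite VC dimension $d$, where the VC dimension is the supremum of the $m\in\{0,1,2,\dots\}$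 such that $|\{(f(x_1),\dots,f(x_m)):f\in\mathcal G\}|=2^m$ for some $x_1,\dots,x_m\in\mathcal X$. Then for every measurable loss $\ell$ with values in $[0,b]$, $$\mathrm{MER}_\ell\le O\Big(\frac{b}{\log 2}\cdot\frac dn\Big),$$ where $\log$ is the natural logarithm and the constant is universal: there is an absolute constant $C>0$, not depending on the spaces, the model, $g$, $d$, $b$, $\ell$ or $n$, such that $\mathrm{MER}_\ell\le C\,\frac{b}{\log 2}\cdot\frac dn$ for all $n\ge1$. -/

import Mathlib

open MeasureTheory ProbabilityTheory

namespace BayesLearning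

/-- The conditional law of `n` samples that are i.i.d. given `W = w`, each with law `κ w`,
as a Markov kernel `w ↦ κ(w)^{⊗ n}`. -/
noncomputable def iidKernel {𝒲 𝒵 : Type*} [MeasurableSpace 𝒲] [MeasurableSpace 𝒵]
    (κ : Kernel 𝒲 𝒵) [IsMarkovKernel κ] (n : ℕ) : Kernel 𝒲 (Fin n → 𝒵) where
  toFun w := Measure.pi fun _ : Fin n => κ w
  measurable' := by
    refine Measurable.measure_of_isPiSystem_of_isProbabilityMeasure
      generateFrom_pi.symm isPiSystem_pi ?_
    rintro s ⟨t, ht, rfl⟩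
    have hm : ∀ i, MeasurableSet (t i) := fun i => ht i (Set.mem_univ i)
    simp only [Measure.pi_pi]
    exact Finset.measurable_prod _ fun i _ => κ.measurable_coe (hm i)

instance {𝒲 𝒵 : Type*} [MeasurableSpace 𝒲] [MeasurableSpace 𝒵]
    (κ : Kernel 𝒲 𝒵) [IsMarkovKernel κ] (n : ℕ) : IsMarkovKernel (iidKernel κ n) where
  isProbabilityMeasure w := by
    change IsProbabilityMeasure (Measure.pi fun _ : Fin n => κ w)
    infer_instance

/-- The joint law of `(W, (Zⁿ, Z))`: the parameter `W` has law `prior`, and given `W = w` the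
data `Z₁, …, Zₙ` and the fresh pair `Z` are i.i.d. with law `κ w`. -/
noncomputable def jointLaw {𝒲 𝒵 : Type*} [MeasurableSpace 𝒲] [MeasurableSpace 𝒵]
    (prior : Measure 𝒲) (κ : Kernel 𝒲 𝒵) [IsMarkovKernel κ] (n : ℕ) :
    Measure (𝒲 × ((Fin n → 𝒵) × 𝒵)) :=
  prior ⊗ₘ (iidKernel κ n ×ₖ κ)

/-- The Bayes risk `R_ℓ(Y | V)`: the infimum of the expected loss `E[ℓ(Y, ψ(V))]` over the
(deterministic, measurable) decision rules `ψ` whose expected loss is defined. -/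
noncomputable def bayesRisk {Ω 𝒱 𝒴 𝒜 : Type*} [MeasurableSpace Ω] [MeasurableSpace 𝒱]
    [MeasurableSpace 𝒜] (P : Measure Ω) (loss : 𝒴 → 𝒜 → ℝ) (Y : Ω → 𝒴) (V : Ω → 𝒱) : ℝ :=
  ⨅ ψ : {ψ : 𝒱 → 𝒜 // Measurable ψ ∧ Integrable (fun ω => loss (Y ω) (ψ (V ω))) P},
    ∫ ω, loss (Y ω) (ψ.1 (V ω)) ∂P

/-- The minimum excess risk `R_ℓ(Y | X, Zⁿ) - R_ℓ(Y | X, W)` for data size `n`, where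
`Z = (X, Y)` and `(W, Zⁿ, Z)` has the law `jointLaw prior κ n`. A point of the sample space is
`ω = (w, (zⁿ, (x, y)))`. -/
noncomputable def minExcessRisk {𝒲 𝒳 𝒴 𝒜 : Type*} [MeasurableSpace 𝒲] [MeasurableSpace 𝒳]
    [MeasurableSpace 𝒴] [MeasurableSpace 𝒜] (prior : Measure 𝒲) (κ : Kernel 𝒲 (𝒳 × 𝒴))
    [IsMarkovKernel κ] (loss : 𝒴 → 𝒜 → ℝ) (n : ℕ) : ℝ :=
  bayesRisk (jointLaw prior κ n) loss (fun ω => ω.2.2.2) (fun ω => (ω.2.2.1, ω.2.1)) -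
    bayesRisk (jointLaw prior κ n) loss (fun ω => ω.2.2.2) (fun ω => (ω.2.2.1, ω.1))

/-- The VC dimension of a class of binary functions: the supremum (in `ℕ ∪ {∞}`) of the `n`
such that the class takes all `2 ^ n` binary patterns on some `n` points. -/
noncomputable def vcDim {𝒳 : Type*} (G : Set (𝒳 → Fin 2)) : ℕ∞ :=
  ⨆ (n : ℕ) (_ : ∃ x : Fin n → 𝒳, ((fun f : 𝒳 → Fin 2 => fun i => f (x i)) '' G).ncard = 2 ^ n),
    (n : ℕ∞)

end BayesLearning

/-! One-inclusion graph prediction with posterior weights. No rule, even one knowing `W`, beats the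
infimum over actions of the loss at the true label. Predicting the label and playing a near-optimal
action for it therefore has excess at most `b` times the error probability (`bayesRisk_sub_le`), and
an error of order `d / n` suffices.

Given `W`, the `n + 1` pairs are i.i.d., so the fresh one may sit at any place `i`
(`jointLaw_map_insertNth`). Conditionally on all `n + 1` observations, the label vector is a random
vertex of a cube, lying in a class of VC dimension at most `d`. Guess label `i` as the likelier one
given the others: an error occurs only at an end of an edge no heavier than the other end. Summed
over `i`, the errors are thus controlled by the edge weights, with total at most `2 * d`
(`sum_min_flipAt_le`), and some `i` does no worse than the average. -/

namespace BayesLearning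

/-! ### Edge density of weighted one-inclusion graphs -/

/-- A set of vertices of the cube takes all patterns on the coordinates in `I`. -/
def CubeShatters {m : ℕ} (S : Set (Fin m → Fin 2)) (I : Finset (Fin m)) : Prop :=
  ∀ s : Fin m → Fin 2, ∃ y ∈ S, ∀ i ∈ I, y i = s i

/-- The neighbour of the vertex `y` of the cube along the coordinate `i`. -/
def flipAt {m : ℕ} (y : Fin m → Fin 2) (i : Fin m) : Fin m → Fin 2 :=
  Function.update y i (y i + 1)

lemma sum_cube_succ {m : ℕ} (f : (Fin (m + 1) → Fin 2) → ℝ) :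
    ∑ y, f y = ∑ z : Fin m → Fin 2, (f (Fin.cons 0 z) + f (Fin.cons 1 z)) := by
  rw [← (Fin.consEquiv fun _ : Fin (m + 1) => Fin 2).sum_comp, Fintype.sum_prod_type,
    Fin.sum_univ_two, ← Finset.sum_add_distrib]
  rfl

lemma flipAt_cons_zero {m : ℕ} (a : Fin 2) (z : Fin m → Fin 2) :
    flipAt (Fin.cons a z : Fin (m + 1) → Fin 2) 0 = Fin.cons (a + 1) z := by
  simp [flipAt]

lemma flipAt_cons_succ {m : ℕ} (a : Fin 2) (z : Fin m → Fin 2) (i : Fin m) :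
    flipAt (Fin.cons a z : Fin (m + 1) → Fin 2) i.succ = Fin.cons a (flipAt z i) := by
  simp [flipAt, Fin.cons_update]

/-- Supermodularity of `min`: pairing large with large and small with small maximizes the sum of
minima. It compares the edges of two half-cubes with those of their pointwise max and min. -/
lemma min_add_min_le (a b c e : ℝ) :
    min a c + min b e ≤ min (max a b) (max c e) + min (min a b) (min c e) := by
  rcases le_total a b with h1 | h1 <;> rcases le_total c e with h2 | h2 <;>
  rcases le_total a c with h3 | h3 <;> rcases le_total b e with h4 | h4 <;>
  rcases le_total a e with h5 | h5 <;> rcases le_total b c with h6 | h6 <;>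
  simp only [h1, h2, h3, h4, h5, h6, min_eq_left, min_eq_right, max_eq_left, max_eq_right] <;>
  linarith

lemma CubeShatters.union_map_succ {m : ℕ} {S : Set (Fin (m + 1) → Fin 2)} {I : Finset (Fin m)}
    (h : CubeShatters {z | Fin.cons 0 z ∈ S ∨ Fin.cons 1 z ∈ S} I) :
    CubeShatters S (I.map (Fin.succEmb m)) := by
  intro s
  obtain ⟨z, hz | hz, hzs⟩ := h (fun i => s i.succ)
  · exact ⟨_, hz, by simpa using hzs⟩
  · exact ⟨_, hz, by simpa using hzs⟩

/-- Both lifts of a common point lie in `S`, so coordinate `0` is free. This extra coordinate lowers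
the dimension by one in the induction. -/
lemma CubeShatters.inter_insert_zero {m : ℕ} {S : Set (Fin (m + 1) → Fin 2)}
    {I : Finset (Fin m)}
    (h : CubeShatters {z | Fin.cons 0 z ∈ S ∧ Fin.cons 1 z ∈ S} I) :
    CubeShatters S (insert 0 (I.map (Fin.succEmb m))) := by
  intro s
  obtain ⟨z, hz, hzs⟩ := h (fun i => s i.succ)
  refine ⟨Fin.cons (s 0) z, ?_, by simpa using hzs⟩
  have : s 0 = 0 ∨ s 0 = 1 := by omega
  rcases this with h | h <;> rw [h]
  exacts [hz.1, hz.2]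

lemma card_insert_zero_map_succ {m : ℕ} (I : Finset (Fin m)) :
    (insert 0 (I.map (Fin.succEmb m))).card = I.card + 1 := by
  rw [Finset.card_insert_of_notMem (by simp), Finset.card_map]

/-- The one-inclusion graph of a class of VC dimension `d` has edge density at most `d`,
in a weighted form: every edge counts twice, with the smaller of the weights of its ends. -/
theorem sum_min_flipAt_le : ∀ (m : ℕ) (p : (Fin m → Fin 2) → ℝ) (d : ℕ), (∀ y, 0 ≤ p y) →
    (∀ I, CubeShatters {y | 0 < p y} I → I.card ≤ d) →
    ∑ y, ∑ i, min (p y) (p (flipAt y i)) ≤ 2 * d * ∑ y, p y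
  | 0, p, d, hp, _ => by
    have : 0 ≤ ∑ y, p y := Finset.sum_nonneg fun y _ => hp y
    simp only [Finset.univ_eq_empty, Finset.sum_empty, Finset.sum_const_zero]
    positivity
  | m + 1, p, d, hp, hI => by
    -- Cut along coordinate `0`. The support of `max u v` is the union of the halves (dimension at
    -- most `d`), that of `min u v` their intersection (at most `d - 1`). The unit saved on the
    -- intersection pays for the edges along coordinate `0`.
    set u : (Fin m → Fin 2) → ℝ := fun z => p (Fin.cons 0 z) with hu
    set v : (Fin m → Fin 2) → ℝ := fun z => p (Fin.cons 1 z) with hv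
    have hmax := sum_min_flipAt_le m (fun z => max (u z) (v z)) d
      (fun z => le_max_of_le_left (hp _)) (fun I h => by
        rw [← Finset.card_map (Fin.succEmb m)]
        refine hI _ (CubeShatters.union_map_succ ?_)
        simpa [lt_max_iff, hu, hv] using h)
    have hsh : ∀ I, CubeShatters {z | 0 < min (u z) (v z)} I → I.card + 1 ≤ d := fun I h => by
      rw [← card_insert_zero_map_succ]
      refine hI _ (CubeShatters.inter_insert_zero ?_)
      simpa [lt_min_iff, hu, hv] using h
    have hmin : ∑ z, ∑ i, min (min (u z) (v z)) (min (u (flipAt z i)) (v (flipAt z i))) +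
        2 * ∑ z, min (u z) (v z) ≤ 2 * d * ∑ z, min (u z) (v z) := by
      rcases d with _ | d
      -- A positive minimum would make coordinate `0` shattered, impossible when `d = 0`.
      · have h0 : ∀ z, min (u z) (v z) = 0 := fun z => by
          by_contra hne
          have hpos : 0 < min (u z) (v z) := lt_of_le_of_ne (le_min (hp _) (hp _)) (Ne.symm hne)
          have := hsh ∅ fun s => ⟨z, hpos, by simp⟩
          omega
        simp [h0]
      · have := sum_min_flipAt_le m (fun z => min (u z) (v z)) d
          (fun z => le_min (hp _) (hp _)) (fun I h => by have := hsh I h; omega)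
        push_cast
        linarith
    have hsum : ∑ z, max (u z) (v z) + ∑ z, min (u z) (v z) = ∑ y, p y := by
      rw [sum_cube_succ, ← Finset.sum_add_distrib]
      exact Finset.sum_congr rfl fun z _ => max_add_min _ _
    have hsplit : ∑ y, ∑ i, min (p y) (p (flipAt y i)) = 2 * ∑ z, min (u z) (v z) +
        ∑ z, ∑ i, (min (u z) (u (flipAt z i)) + min (v z) (v (flipAt z i))) := by
      rw [sum_cube_succ, Finset.mul_sum, ← Finset.sum_add_distrib]
      refine Finset.sum_congr rfl fun z _ => ?_
      rw [Fin.sum_univ_succ, Fin.sum_univ_succ, Finset.sum_add_distrib]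
      simp only [flipAt_cons_zero, flipAt_cons_succ, zero_add,
        show (1 + 1 : Fin 2) = 0 from rfl]
      rw [min_comm (p (Fin.cons 1 z)) (p (Fin.cons 0 z))]
      simp only [hu, hv]
      ring
    have hle : ∑ z, ∑ i, (min (u z) (u (flipAt z i)) + min (v z) (v (flipAt z i))) ≤
        ∑ z, ∑ i, min (max (u z) (v z)) (max (u (flipAt z i)) (v (flipAt z i))) +
        ∑ z, ∑ i, min (min (u z) (v z)) (min (u (flipAt z i)) (v (flipAt z i))) := by
      simp only [← Finset.sum_add_distrib]
      exact Finset.sum_le_sum fun z _ => Finset.sum_le_sum fun i _ => min_add_min_le _ _ _ _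
    rw [hsplit, ← hsum]
    linarith

/-! ### Predicting one label from the others -/

/-- A set of coordinates shattered by the restriction of `G` to finitely many points has at most
`d` elements if `G` has VC dimension `d`. -/
lemma CubeShatters.card_le_of_vcDim {𝒳 : Type*} {G : Set (𝒳 → Fin 2)} {d : ℕ}
    (hd : vcDim G = d) {m : ℕ} {x : Fin m → 𝒳} {I : Finset (Fin m)}
    (h : CubeShatters ((fun f : 𝒳 → Fin 2 => fun i => f (x i)) '' G) I) : I.card ≤ d := by
  have key : (I.card : ℕ∞) ≤ vcDim G := by
    refine le_iSup₂_of_le I.card ⟨fun j => x (I.equivFin.symm j), ?_⟩ le_rfl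
    have huniv : ((fun f : 𝒳 → Fin 2 => fun j => f (x (I.equivFin.symm j))) '' G) =
        Set.univ := by
      refine Set.eq_univ_of_forall fun s => ?_
      -- The value `0` off `I` is arbitrary; only coordinates in `I` are read.
      obtain ⟨_, ⟨f, hf, rfl⟩, hy⟩ := h fun i => if hi : i ∈ I then s (I.equivFin ⟨i, hi⟩) else 0
      refine ⟨f, hf, funext fun j => ?_⟩
      have := hy _ (I.equivFin.symm j).2
      simpa using this
    rw [huniv, Set.ncard_univ]
    simp
  rw [hd] at key
  exact_mod_cast key

/-- The likelier label at the coordinate `i`, given the other coordinates of `y`. -/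
noncomputable def likelierLabel {m : ℕ} (p : (Fin m → Fin 2) → ℝ) (i : Fin m)
    (y : Fin m → Fin 2) : Fin 2 :=
  if p (Function.update y i 0) ≤ p (Function.update y i 1) then 1 else 0

/-- The guess ignores the label at `i`, hence is available when that label is hidden. -/
lemma likelierLabel_update {m : ℕ} (p : (Fin m → Fin 2) → ℝ) (i : Fin m) (y : Fin m → Fin 2)
    (a : Fin 2) : likelierLabel p i (Function.update y i a) = likelierLabel p i y := by
  simp [likelierLabel]

lemma measurable_likelierLabel {α : Type*} [MeasurableSpace α] {m : ℕ}
    {p : α → (Fin m → Fin 2) → ℝ} (hp : ∀ y, Measurable fun x => p x y) (i : Fin m) :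
    Measurable fun q : α × (Fin m → Fin 2) => likelierLabel (p q.1) i q.2 :=
  measurable_from_prod_countable_left fun y =>
    Measurable.ite (measurableSet_le (hp (Function.update y i 0)) (hp (Function.update y i 1)))
      measurable_const measurable_const

lemma le_flipAt_of_likelierLabel_ne {m : ℕ} {p : (Fin m → Fin 2) → ℝ} {i : Fin m}
    {y : Fin m → Fin 2} (h : likelierLabel p i y ≠ y i) : p y ≤ p (flipAt y i) := by
  have hy : Function.update y i (y i) = y := Function.update_eq_self i y
  unfold likelierLabel at h
  unfold flipAt
  have h01 : y i = 0 ∨ y i = 1 := by omega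
  rcases h01 with h0 | h0 <;> rw [h0] at h hy ⊢
  · split_ifs at h with hle
    · simpa [hy] using hle
    · exact absurd rfl h
  · split_ifs at h with hle
    · exact absurd rfl h
    · rw [hy] at hle
      exact (not_le.1 hle).le

/-- If a random vertex of the cube lies in a class of VC dimension at most `d`, the expected
number of coordinates wrongly predicted from the other ones is at most `2 * d`. -/
theorem sum_measureReal_likelierLabel_ne_le {𝒲 : Type*} [MeasurableSpace 𝒲] {m : ℕ}
    (μ : Measure 𝒲) [IsProbabilityMeasure μ] {G : 𝒲 → Fin m → Fin 2} (hG : Measurable G) {d : ℕ}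
    (hd : ∀ I, CubeShatters (Set.range G) I → I.card ≤ d) :
    ∑ i, μ.real {w | likelierLabel (fun y => μ.real (G ⁻¹' {y})) i (G w) ≠ G w i} ≤ 2 * d := by
  set p : (Fin m → Fin 2) → ℝ := fun y => μ.real (G ⁻¹' {y}) with hp
  have hpre : ∀ F : Finset (Fin m → Fin 2), μ.real (G ⁻¹' F) = ∑ y ∈ F, p y := fun F =>
    (sum_measureReal_preimage_singleton F fun y _ => hG (measurableSet_singleton y)).symm
  have htot : ∑ y, p y = 1 := by
    rw [← hpre Finset.univ]
    simp
  have hle : ∀ i, μ.real {w | likelierLabel p i (G w) ≠ G w i} ≤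
      ∑ y, min (p y) (p (flipAt y i)) := fun i => by
    have : {w | likelierLabel p i (G w) ≠ G w i} =
        G ⁻¹' ((Finset.univ.filter fun y => likelierLabel p i y ≠ y i : Finset _) : Set _) := by
      ext w
      simp
    rw [this, hpre]
    refine (Finset.sum_le_sum fun y hy => ?_).trans
      (Finset.sum_le_sum_of_subset_of_nonneg (Finset.filter_subset _ _) fun y _ _ =>
        le_min measureReal_nonneg measureReal_nonneg)
    exact le_min le_rfl (le_flipAt_of_likelierLabel_ne (Finset.mem_filter.1 hy).2)
  calc _ ≤ ∑ i, ∑ y, min (p y) (p (flipAt y i)) := Finset.sum_le_sum fun i _ => hle i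
    _ = ∑ y, ∑ i, min (p y) (p (flipAt y i)) := Finset.sum_comm
    _ ≤ 2 * d * ∑ y, p y := by
      refine sum_min_flipAt_le m p d (fun y => measureReal_nonneg) fun I hI => hd I fun s => ?_
      obtain ⟨y, hy, hys⟩ := hI s
      obtain ⟨w, hw⟩ : (G ⁻¹' {y}).Nonempty := by
        by_contra hne
        rw [Set.not_nonempty_iff_eq_empty] at hne
        simp [hp, hne] at hy
      exact ⟨y, ⟨w, hw⟩, hys⟩
    _ = 2 * d := by rw [htot, mul_one]

section Exchangeability

variable {𝒲 𝒵 : Type*} [MeasurableSpace 𝒲] [MeasurableSpace 𝒵]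

lemma measurable_insertNth_sample {n : ℕ} (i : Fin (n + 1)) :
    Measurable fun q : (Fin n → 𝒵) × 𝒵 => (i.insertNth q.2 q.1 : Fin (n + 1) → 𝒵) :=
  (MeasurableEquiv.piFinSuccAbove (fun _ : Fin (n + 1) => 𝒵) i).symm.measurable.comp
    measurable_swap

/-- The fresh pair may be inserted at any place of the sample. -/
lemma jointLaw_map_insertNth (prior : Measure 𝒲) [IsProbabilityMeasure prior] (κ : Kernel 𝒲 𝒵)
    [IsMarkovKernel κ] {n : ℕ} (i : Fin (n + 1)) :
    (jointLaw prior κ n).map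
      (fun ω => (ω.1, (i.insertNth ω.2.2 ω.2.1 : Fin (n + 1) → 𝒵))) =
      prior ⊗ₘ iidKernel κ (n + 1) := by
  have hT : Measurable fun ω : 𝒲 × ((Fin n → 𝒵) × 𝒵) =>
      (ω.1, (i.insertNth ω.2.2 ω.2.1 : Fin (n + 1) → 𝒵)) :=
    measurable_fst.prodMk ((measurable_insertNth_sample i).comp measurable_snd)
  ext s hs
  rw [Measure.map_apply hT hs, jointLaw, Measure.compProd_apply (hT hs),
    Measure.compProd_apply hs]
  refine lintegral_congr fun w => ?_
  have hmp := ((measurePreserving_piFinSuccAbove (fun _ : Fin (n + 1) => κ w) i).symm).comp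
    (Measure.measurePreserving_swap (μ := Measure.pi fun _ : Fin n => κ w) (ν := κ w))
  have := hmp.measure_preimage (measurable_prodMk_left hs (x := w)).nullMeasurableSet
  rw [Kernel.prod_apply]
  exact this

end Exchangeability

section Realizable

variable {𝒲 𝒳 : Type*} [MeasurableSpace 𝒲] [MeasurableSpace 𝒳]

lemma measurable_sampleLabels {g : 𝒳 → 𝒲 → Fin 2} (hg : Measurable (Function.uncurry g))
    (m : ℕ) : Measurable fun q : (Fin m → 𝒳) × 𝒲 => fun i => g (q.1 i) q.2 :=
  measurable_pi_lambda _ fun i =>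
    Measurable.comp (f := fun q : (Fin m → 𝒳) × 𝒲 => (q.1 i, q.2)) hg (by fun_prop)

lemma ae_sample_realizable {prior : Measure 𝒲} [IsProbabilityMeasure prior]
    {κ : Kernel 𝒲 (𝒳 × Fin 2)} [IsMarkovKernel κ] {g : 𝒳 → 𝒲 → Fin 2}
    (hg : Measurable (Function.uncurry g))
    (hreal : ∀ᵐ p ∂(prior ⊗ₘ κ), p.2.2 = g p.2.1 p.1) (m : ℕ) :
    ∀ᵐ q ∂(prior ⊗ₘ iidKernel κ m), ∀ i, (q.2 i).2 = g (q.2 i).1 q.1 := by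
  refine ae_all_iff.2 fun i => ?_
  have hmeas : MeasurableSet {q : 𝒲 × (Fin m → 𝒳 × Fin 2) | (q.2 i).2 = g (q.2 i).1 q.1} := by
    have hi : Measurable fun q : 𝒲 × (Fin m → 𝒳 × Fin 2) => q.2 i :=
      (measurable_pi_apply i).comp measurable_snd
    exact measurableSet_eq_fun (measurable_snd.comp hi)
      (hg.comp ((measurable_fst.comp hi).prodMk measurable_fst))
  refine Measure.ae_compProd_of_ae_ae hmeas ?_
  filter_upwards [Measure.ae_ae_of_ae_compProd hreal] with w hw
  exact (measurePreserving_eval (fun _ : Fin m => κ w) i).quasiMeasurePreserving.ae hw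

/-- For a parameter `W` and observations `x` with joint law `ρ`, there is a coordinate whose label
is predicted from `x` and the other labels with error probability at most `2 * d / (n + 1)`. -/
theorem exists_coordinate_predictor [StandardBorelSpace 𝒲] {n : ℕ}
    (ρ : Measure ((Fin (n + 1) → 𝒳) × 𝒲)) [IsProbabilityMeasure ρ]
    {g : 𝒳 → 𝒲 → Fin 2} (hg : Measurable (Function.uncurry g)) {d : ℕ}
    (hd : vcDim (Set.range fun w => fun x => g x w) = d) :
    ∃ (i : Fin (n + 1)) (h : (Fin (n + 1) → 𝒳) × (Fin (n + 1) → Fin 2) → Fin 2), Measurable h ∧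
      (∀ x y a, h (x, Function.update y i a) = h (x, y)) ∧
      ρ.real {q | h (q.1, fun j => g (q.1 j) q.2) ≠ g (q.1 i) q.2} ≤ 2 * d / (n + 1) := by
  have hW : Nonempty 𝒲 := (nonempty_of_isProbabilityMeasure ρ).map Prod.snd
  have hG := measurable_sampleLabels hg (n + 1)
  set G : (Fin (n + 1) → 𝒳) × 𝒲 → Fin (n + 1) → Fin 2 := fun q i => g (q.1 i) q.2
  let p : (Fin (n + 1) → 𝒳) → (Fin (n + 1) → Fin 2) → ℝ :=
    fun x y => (ρ.condKernel x).real ((fun w => G (x, w)) ⁻¹' {y})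
  have hpm : ∀ y, Measurable fun x => p x y := fun y =>
    (Kernel.measurable_kernel_prodMk_left (hG (measurableSet_singleton y))).ennreal_toReal
  have hhm := measurable_likelierLabel hpm
  let B : Fin (n + 1) → Set ((Fin (n + 1) → 𝒳) × 𝒲) :=
    fun i => {q | likelierLabel (p q.1) i (G q) ≠ G q i}
  have hBm : ∀ i, MeasurableSet (B i) := fun i =>
    (measurableSet_eq_fun ((hhm i).comp (measurable_fst.prodMk hG))
      ((measurable_pi_apply i).comp hG)).compl
  have hsec : ∀ x, ∑ i, ρ.condKernel x (Prod.mk x ⁻¹' B i) ≤ ENNReal.ofReal (2 * d) := fun x => by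
    have := sum_measureReal_likelierLabel_ne_le (ρ.condKernel x) (G := fun w => G (x, w))
      (hG.comp measurable_prodMk_left) (d := d) fun I hI => by
        refine CubeShatters.card_le_of_vcDim hd (x := x) fun s => ?_
        obtain ⟨_, ⟨w, rfl⟩, hw⟩ := hI s
        exact ⟨_, ⟨_, ⟨w, rfl⟩, rfl⟩, hw⟩
    refine le_trans (le_of_eq ?_) (ENNReal.ofReal_le_ofReal this)
    rw [ENNReal.ofReal_sum_of_nonneg fun i _ => measureReal_nonneg]
    exact Finset.sum_congr rfl fun i _ => (ofReal_measureReal (measure_ne_top _ _)).symm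
  have hsum : ∑ i, ρ (B i) ≤ ENNReal.ofReal (2 * d) := by
    have hdis : ∀ i, ρ (B i) = ∫⁻ x, ρ.condKernel x (Prod.mk x ⁻¹' B i) ∂ρ.fst := fun i => by
      rw [← Measure.compProd_apply (hBm i), ρ.disintegrate ρ.condKernel]
    simp only [hdis]
    rw [← lintegral_finsetSum _ fun i _ => Kernel.measurable_kernel_prodMk_left (hBm i)]
    refine (lintegral_mono hsec).trans ?_
    simp
  have hsumR : ∑ i, ρ.real (B i) ≤ 2 * d := by
    have := ENNReal.toReal_mono ENNReal.ofReal_ne_top hsum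
    rwa [ENNReal.toReal_sum fun i _ => measure_ne_top _ _,
      ENNReal.toReal_ofReal (by positivity)] at this
  obtain ⟨i, -, hi⟩ : ∃ i ∈ Finset.univ, ρ.real (B i) ≤ 2 * d / (n + 1) := by
    refine Finset.exists_le_of_sum_le Finset.univ_nonempty (hsumR.trans (le_of_eq ?_))
    simp only [Finset.sum_const, Finset.card_univ, Fintype.card_fin, nsmul_eq_mul]
    push_cast
    field_simp
  exact ⟨i, _, hhm i, fun x y a => likelierLabel_update _ _ _ _, hi⟩

/-- In a realizable model of VC dimension `d`, some measurable predictor of the label of the fresh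
observation errs with probability at most `2 * d / (n + 1)`. -/
theorem exists_predictor [StandardBorelSpace 𝒲] (prior : Measure 𝒲)
    [IsProbabilityMeasure prior] (κ : Kernel 𝒲 (𝒳 × Fin 2)) [IsMarkovKernel κ]
    {g : 𝒳 → 𝒲 → Fin 2} (hg : Measurable (Function.uncurry g))
    (hreal : ∀ᵐ p ∂(prior ⊗ₘ κ), p.2.2 = g p.2.1 p.1) {d : ℕ}
    (hd : vcDim (Set.range fun w => fun x => g x w) = d) (n : ℕ) :
    ∃ h : 𝒳 × (Fin n → 𝒳 × Fin 2) → Fin 2, Measurable h ∧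
      (jointLaw prior κ n).real {ω | h (ω.2.2.1, ω.2.1) ≠ ω.2.2.2} ≤ 2 * d / (n + 1) := by
  let T : 𝒲 × (Fin (n + 1) → 𝒳 × Fin 2) → (Fin (n + 1) → 𝒳) × 𝒲 :=
    fun q => (fun i => (q.2 i).1, q.1)
  have hT : Measurable T := by fun_prop
  have : IsProbabilityMeasure ((prior ⊗ₘ iidKernel κ (n + 1)).map T) :=
    Measure.isProbabilityMeasure_map hT.aemeasurable
  obtain ⟨i, h, hh, hupd, hi⟩ :=
    exists_coordinate_predictor ((prior ⊗ₘ iidKernel κ (n + 1)).map T) hg hd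
  have hG := measurable_sampleLabels hg (n + 1)
  have hBm : MeasurableSet {q : (Fin (n + 1) → 𝒳) × 𝒲 |
      h (q.1, fun j => g (q.1 j) q.2) ≠ g (q.1 i) q.2} :=
    (measurableSet_eq_fun (hh.comp (measurable_fst.prodMk hG))
      ((measurable_pi_apply i).comp hG)).compl
  let E : Set (𝒲 × (Fin (n + 1) → 𝒳 × Fin 2)) :=
    {q | h (fun j => (q.2 j).1, fun j => (q.2 j).2) ≠ (q.2 i).2}
  have hEm : MeasurableSet E := (measurableSet_eq_fun
    (hh.comp (g := h) (f := fun q : 𝒲 × (Fin (n + 1) → 𝒳 × Fin 2) =>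
      (fun j => (q.2 j).1, fun j => (q.2 j).2)) (by fun_prop)) (by fun_prop)).compl
  have hS : Measurable fun ω : 𝒲 × ((Fin n → 𝒳 × Fin 2) × (𝒳 × Fin 2)) =>
      (ω.1, (i.insertNth ω.2.2 ω.2.1 : Fin (n + 1) → 𝒳 × Fin 2)) :=
    measurable_fst.prodMk ((measurable_insertNth_sample i).comp measurable_snd)
  refine ⟨fun v => h (i.insertNth v.1 fun j => (v.2 j).1, i.insertNth 0 fun j => (v.2 j).2),
    hh.comp (Measurable.prodMk ?_ ?_), le_trans (le_of_eq ?_) hi⟩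
  · exact (measurable_insertNth_sample (𝒵 := 𝒳) i).comp
      (f := fun v : 𝒳 × (Fin n → 𝒳 × Fin 2) => (fun j => (v.2 j).1, v.1)) (by fun_prop)
  · exact (measurable_insertNth_sample (𝒵 := Fin 2) i).comp
      (f := fun v : 𝒳 × (Fin n → 𝒳 × Fin 2) => (fun j => (v.2 j).2, (0 : Fin 2))) (by fun_prop)
  · trans (prior ⊗ₘ iidKernel κ (n + 1)).real E
    · rw [← jointLaw_map_insertNth prior κ i, map_measureReal_apply hS hEm]
      congr 1
      ext ω
      have h1 : (fun j => ((i.insertNth ω.2.2 ω.2.1 : Fin (n + 1) → 𝒳 × Fin 2) j).1) =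
          i.insertNth ω.2.2.1 fun j => (ω.2.1 j).1 :=
        funext fun j => by refine i.succAboveCases ?_ (fun k => ?_) j <;> simp
      have h2 : (fun j => ((i.insertNth ω.2.2 ω.2.1 : Fin (n + 1) → 𝒳 × Fin 2) j).2) =
          Function.update (i.insertNth 0 fun j => (ω.2.1 j).2) i ω.2.2.2 :=
        funext fun j => by refine i.succAboveCases ?_ (fun k => ?_) j <;> simp
      change _ ≠ _ ↔ h (_, _) ≠
        ((i.insertNth ω.2.2 ω.2.1 : Fin (n + 1) → 𝒳 × Fin 2) i).2
      rw [h1, h2, hupd, Fin.insertNth_apply_same]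
    · rw [map_measureReal_apply hT hBm]
      refine measureReal_congr ?_
      filter_upwards [ae_sample_realizable hg hreal (n + 1)] with q hq
      have hlab : (fun j => (q.2 j).2) = fun j => g (q.2 j).1 q.1 := funext hq
      refine propext ?_
      change h (fun j => (q.2 j).1, fun j => (q.2 j).2) ≠ (q.2 i).2 ↔
        h (fun j => (q.2 j).1, fun j => g (q.2 j).1 q.1) ≠ g (q.2 i).1 q.1
      rw [hlab, hq i]

end Realizable

/-- A bounded loss: predicting the label and then acting (almost) optimally for the predicted
label costs at most `b` times the probability of a wrong prediction. -/
theorem bayesRisk_sub_le {Ω 𝒱 𝒱' 𝒜 : Type*} [MeasurableSpace Ω] [MeasurableSpace 𝒱]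
    [MeasurableSpace 𝒱'] [MeasurableSpace 𝒜] [Nonempty 𝒜] (P : Measure Ω)
    [IsProbabilityMeasure P] {b : ℝ} {loss : Fin 2 → 𝒜 → ℝ}
    (hloss : Measurable (Function.uncurry loss)) (hb : ∀ y a, loss y a ∈ Set.Icc 0 b)
    {Y : Ω → Fin 2} (hY : Measurable Y) {V : Ω → 𝒱} (hV : Measurable V)
    (V' : Ω → 𝒱') {h : 𝒱 → Fin 2} (hh : Measurable h) :
    bayesRisk P loss Y V - bayesRisk P loss Y V' ≤ b * P.real {ω | h (V ω) ≠ Y ω} := by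
  have hint : ∀ {A : Ω → 𝒜}, Measurable A → Integrable (fun ω => loss (Y ω) (A ω)) P := by
    intro A hA
    refine Integrable.of_bound (hloss.comp (hY.prodMk hA)).aestronglyMeasurable b
      (.of_forall fun ω => ?_)
    rw [Real.norm_of_nonneg (hb _ _).1]
    exact (hb _ _).2
  have hbdd : ∀ y, BddBelow (Set.range (loss y)) := fun y =>
    ⟨0, by rintro _ ⟨a, rfl⟩; exact (hb y a).1⟩
  have hminle : ∀ y a, ⨅ a, loss y a ≤ loss y a := fun y a => ciInf_le (hbdd y) a
  have hmin0 : ∀ y, 0 ≤ ⨅ a, loss y a := fun y => le_ciInf fun a => (hb y a).1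
  have hb0 : 0 ≤ b := (hb 0 (Classical.arbitrary 𝒜)).1.trans (hb 0 (Classical.arbitrary 𝒜)).2
  have hmint : Integrable (fun ω => ⨅ a, loss (Y ω) a) P := by
    refine Integrable.of_bound
      ((measurable_of_countable fun y : Fin 2 => ⨅ a, loss y a).comp hY).aestronglyMeasurable b
      (.of_forall fun ω => ?_)
    rw [Real.norm_of_nonneg (hmin0 _)]
    exact (hminle _ (Classical.arbitrary 𝒜)).trans (hb _ _).2
  have hlower : ∫ ω, ⨅ a, loss (Y ω) a ∂P ≤ bayesRisk P loss Y V' := by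
    have : Nonempty {ψ : 𝒱' → 𝒜 //
        Measurable ψ ∧ Integrable (fun ω => loss (Y ω) (ψ (V' ω))) P} :=
      ⟨⟨fun _ => Classical.arbitrary 𝒜, measurable_const, hint measurable_const⟩⟩
    exact le_ciInf fun ψ => integral_mono hmint ψ.2.2 fun ω => hminle _ _
  refine le_of_forall_pos_le_add fun ε hε => ?_
  have hex : ∀ y, ∃ a, loss y a < (⨅ a, loss y a) + ε := fun y =>
    exists_lt_of_ciInf_lt (lt_add_of_pos_right _ hε)
  choose act hact using hex
  have hψ : Measurable fun v => act (h v) := (measurable_of_countable act).comp hh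
  have hset : MeasurableSet {ω | h (V ω) ≠ Y ω} :=
    (measurableSet_eq_fun (hh.comp hV) hY).compl
  have hmε : Integrable (fun ω => (⨅ a, loss (Y ω) a) + ε) P := hmint.add (integrable_const ε)
  have hupper : bayesRisk P loss Y V ≤
      ∫ ω, ((⨅ a, loss (Y ω) a) + ε + {ω | h (V ω) ≠ Y ω}.indicator (fun _ => b) ω) ∂P := by
    refine (ciInf_le ⟨0, ?_⟩ ⟨_, hψ, hint (hψ.comp hV)⟩).trans ?_
    · rintro _ ⟨ψ, rfl⟩
      exact integral_nonneg fun ω => (hb _ _).1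
    · refine integral_mono (hint (hψ.comp hV))
        (hmε.add ((integrable_const b).indicator hset)) fun ω => ?_
      by_cases hω : h (V ω) = Y ω
      · simpa [hω] using (hact (Y ω)).le
      · have : loss (Y ω) (act (h (V ω))) ≤ b := (hb _ _).2
        have := hmin0 (Y ω)
        simp only [Set.mem_ofPred_eq, ne_eq, hω, not_false_eq_true, Set.indicator_of_mem]
        linarith
  rw [integral_add hmε ((integrable_const b).indicator hset),
    integral_add hmint (integrable_const ε), integral_indicator_const b hset] at hupper
  simp only [integral_const, probReal_univ, smul_eq_mul] at hupper
  linarith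

end BayesLearning

theorem mainTheorem6 :
    ∃ C : ℝ, 0 < C ∧
      ∀ {𝒲 : Type*} {𝒳 : Type*} {𝒜 : Type*}
        [MeasurableSpace 𝒲] [StandardBorelSpace 𝒲] [MeasurableSpace 𝒳] [StandardBorelSpace 𝒳]
        [MeasurableSpace 𝒜] [Nonempty 𝒜]
        (prior : Measure 𝒲) [IsProbabilityMeasure prior]
        (κ : Kernel 𝒲 (𝒳 × Fin 2)) [IsMarkovKernel κ]
        (g : 𝒳 → 𝒲 → Fin 2) (_ : Measurable (Function.uncurry g))
        (_ : ∀ᵐ p ∂(prior ⊗ₘ κ), p.2.2 = g p.2.1 p.1)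
        (d : ℕ) (_ : BayesLearning.vcDim (Set.range fun w => fun x => g x w) = (d : ℕ∞))
        (b : ℝ) (loss : Fin 2 → 𝒜 → ℝ) (_ : Measurable (Function.uncurry loss))
        (_ : ∀ y a, loss y a ∈ Set.Icc 0 b)
        (n : ℕ) (_ : 1 ≤ n),
        BayesLearning.minExcessRisk prior κ loss n ≤ C * (b / Real.log 2 * (d / n)) := by
  refine ⟨2, two_pos, ?_⟩
  intro 𝒲 𝒳 𝒜 _ _ _ _ _ _ prior _ κ _ g hg hreal d hd b loss hloss hb n hn
  obtain ⟨h, hh, herr⟩ := BayesLearning.exists_predictor prior κ hg hreal hd n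
  have : IsProbabilityMeasure (BayesLearning.jointLaw prior κ n) := by
    unfold BayesLearning.jointLaw
    infer_instance
  have hb0 : 0 ≤ b := (hb 0 (Classical.arbitrary 𝒜)).1.trans (hb 0 (Classical.arbitrary 𝒜)).2
  have hn0 : (0 : ℝ) < n := by exact_mod_cast hn
  have hlog : 0 < Real.log 2 := Real.log_pos one_lt_two
  have hlog1 : Real.log 2 ≤ 1 := by
    have := Real.log_le_sub_one_of_pos (show (0 : ℝ) < 2 by norm_num)
    linarith
  have hbayes := BayesLearning.bayesRisk_sub_le (BayesLearning.jointLaw prior κ n) hloss hb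
    (Y := fun ω => ω.2.2.2) (by fun_prop) (V := fun ω => (ω.2.2.1, ω.2.1)) (by fun_prop)
    (fun ω => (ω.2.2.1, ω.1)) hh
  calc BayesLearning.minExcessRisk prior κ loss n
      ≤ b * (2 * d / (n + 1)) := hbayes.trans (mul_le_mul_of_nonneg_left herr hb0)
    _ ≤ b / Real.log 2 * (2 * d / n) := by
      gcongr
      · exact le_div_self hb0 hlog hlog1
      · linarith
    _ = 2 * (b / Real.log 2 * (d / n)) := by ring
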